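/- Let $S$ be a measurable space and let $(\kappa_n)_{n\ge 0}$ be Markov kernels on $S$, $\kappa_n$ being the transition kernel from time $n$ to time $n+1$ of a (non-homogeneous) Markov chain. Let $P_{t,x}(t+m,\cdot)$ be the transition probability from the state $x$ at time $t$ to time $t+m$, and let $P_\mu(n,\cdot)$ be the law of the chain at time $n$ when its law at time $0$ is the probability measure $\mu$. For $m\ge 1$, $t\ge 0$ and $x=(x^1,x^2)\in S^2$ put $$\alpha^{(m)}_t(x)=\int\Big(\frac{P_{t,x^2}(t+m,dy)}{P_{t,x^1}(t+m,dy)}\wedge 1\Big)P_{t,x^1}(t+m,dy),$$ where the fraction is the density of the absolutely continuous component. Let $\Lambda=\frac12\big(P_{t,x^1}(t+m,\cdot)+P_{t,x^2}(t+m,\cdot)\big)$, let $p^1,p^2$ be the densities of $P_{t,x^1}(t+m,\cdot)$ and $P_{t,x^2}(t+m,\cdot)$ with respect to $\Lambda$, and, if $\alpha^{(m)}_t(x)<1$, let $\eta^1,\eta^2$ be independent with the densities $$\frac{p^i-p^1\wedge p^2}{1-\alpha^{(m)}_t(x)}\qquad(i=1,2)$$ with respect to $\Lambda$ (the law of the coupled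 pair at time $t+m$ on condition that the coupling has not succeeded). Define, for bounded measurable $h:S^2\to\mathbb R$, $$V^{(m)}_t h(x)=\big(1-\alpha^{(m)}_t(x)\big)\,\mathsf E\,h(\eta^1,\eta^2),$$ which is $0$ if $\alpha_t^{(m)}(x)=1$ (lower integrals of $h^+$ and $h^-$ being used for functions that are not measurable), and let $$\prod_{i=0}^{n-1}V^{(m)}_{im}=V^{(m)}_0V^{(m)}_mV^{(m)}_{2m}\cdots V^{(m)}_{(n-1)m}.$$ Let $\|\cdot\|$ be the operator norm with respect to the supremum norm on bounded measurable functions, let $\|\cdot\|_{TV}$ be the total variation norm, and put $\ln 0=-\infty$. Then the following holds. 1. For every $m\ge 1$ and all probability measures $\mu^1,\mu^2$ on $S$, $$\limsup_{n\to\infty}\frac1n\ln\|P_{\mu^1}(n,\cdot)-P_{\mu^2}(n,\cdot)\|_{TV}\le\limsup_{n\to\infty}\frac1{nm}\ln\iint\Big(\prod_{i=0}^{n-1}V^{(m)}_{im}\Big)\mathbf 1(x^1,x^2)\,1(x^1\ne x^2)\,\mu^1(dx^1)\,\mu^2(dx^2).$$ 2. For all probability measures $\mu^1,\mu^2$ on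 $S$, $$\limsup_{n\to\infty}\frac1n\ln\|P_{\mu^1}(n,\cdot)-P_{\mu^2}(n,\cdot)\|_{TV}\le\liminf_{m\to\infty}\limsup_{n\to\infty}\frac1{nm}\ln\Big\|\prod_{i=0}^{n-1}V^{(m)}_{im}\Big\|.$$ 3. The bound in 2 is uniform with respect to the initial measures: $$\limsup_{n\to\infty}\frac1n\ln\sup_{\mu^1,\mu^2}\|P_{\mu^1}(n,\cdot)-P_{\mu^2}(n,\cdot)\|_{TV}\le\liminf_{m\to\infty}\limsup_{n\to\infty}\frac1{nm}\ln\Big\|\prod_{i=0}^{n-1}V^{(m)}_{im}\Big\|.$$ -/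

import Mathlib

open MeasureTheory ProbabilityTheory Filter
open scoped ENNReal

noncomputable section

namespace NonhomChain

variable {S : Type*} [MeasurableSpace S]

/-- The transition kernel from time `t` to time `t + m`, that is `x ↦ P_{t,x}(t+m, ·)`, of the
non-homogeneous Markov chain whose one-step kernel at time `n` (from time `n` to time `n + 1`)
is `κ n`. -/
def trans (κ : ℕ → Kernel S S) (t : ℕ) : ℕ → Kernel S S
  | 0 => Kernel.id
  | m + 1 => (κ (t + m)).comp (trans κ t m)

instance trans_isMarkovKernel (κ : ℕ → Kernel S S) [∀ n, IsMarkovKernel (κ n)] (t m : ℕ) :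
    IsMarkovKernel (trans κ t m) := by
  induction m with
  | zero => unfold trans; infer_instance
  | succ m ih => unfold trans; infer_instance

/-- The law `P_μ(n, ·)` at time `n` of the chain with initial law `μ` at time `0`. -/
def law (κ : ℕ → Kernel S S) (μ : Measure S) (n : ℕ) : Measure S :=
  μ.bind (trans κ 0 n)

instance law_isProbabilityMeasure (κ : ℕ → Kernel S S) [∀ n, IsMarkovKernel (κ n)]
    (μ : Measure S) [IsProbabilityMeasure μ] (n : ℕ) : IsProbabilityMeasure (law κ μ n) := by
  unfold law; infer_instance

/-- The total variation norm `‖μ - ν‖_TV` (total mass of the variation of the signed measure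
`μ - ν`). -/
def tvDist (μ ν : Measure S) [IsFiniteMeasure μ] [IsFiniteMeasure ν] : ℝ≥0∞ :=
  (μ.toSignedMeasure - ν.toSignedMeasure).totalVariation Set.univ

/-- `α(P, Q) = ∫ (dQ/dP ∧ 1) dP`, where `dQ/dP` is the density of the absolutely continuous
component of `Q` with respect to `P`. -/
def overlap (P Q : Measure S) : ℝ≥0∞ :=
  ∫⁻ y, min (Q.rnDeriv P y) 1 ∂P

/-- The reference measure `Λ = (P + Q) / 2`. -/
def refMeasure (P Q : Measure S) : Measure S := (2 : ℝ≥0∞)⁻¹ • (P + Q)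

open scoped Classical in
/-- The law of the uncoupled variable `η` associated with `P` and the competitor `Q`: with `p`, `q`
the densities of `P`, `Q` with respect to `Λ = (P + Q) / 2`, it has the density
`(p - p ∧ q) / (1 - α(P, Q))` with respect to `Λ`. In the degenerate case `α(P, Q) = 1`, where the
choice is irrelevant, it is `P`. -/
def residual (P Q : Measure S) : Measure S :=
  if overlap P Q = 1 then P
  else (1 - overlap P Q)⁻¹ • (refMeasure P Q).withDensity (fun y =>
    P.rnDeriv (refMeasure P Q) y -
      min (P.rnDeriv (refMeasure P Q) y) (Q.rnDeriv (refMeasure P Q) y))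

/-- `α_t^{(m)}(x¹, x²)`. -/
def alpha (κ : ℕ → Kernel S S) (m t : ℕ) (x : S × S) : ℝ≥0∞ :=
  overlap (trans κ t m x.1) (trans κ t m x.2)

/-- The law at time `t + m` of the coupled pair that was at `x = (x¹, x²)` at time `t`, on
condition that the two components have not been coupled in between: the components are then
the independent variables `η¹`, `η²` with the residual laws. -/
def uncoupledLaw (κ : ℕ → Kernel S S) (m t : ℕ) (x : S × S) : Measure (S × S) :=
  (residual (trans κ t m x.1) (trans κ t m x.2)).prod
    (residual (trans κ t m x.2) (trans κ t m x.1))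

/-- The operator `V_t^{(m)}`,
`V_t^{(m)} h (x) = (1 - α_t^{(m)}(x)) ∫ h d(uncoupledLaw at x)`.
The integral is written as the difference of the integrals of `h⁺` and `h⁻`, which is the usual
integral for bounded measurable `h` (see `V_eq_integral`) and which uses lower integrals
if `h` is not measurable. -/
def V (κ : ℕ → Kernel S S) (m t : ℕ) (h : S × S → ℝ) (x : S × S) : ℝ :=
  (1 - (alpha κ m t x).toReal) *
    ((∫⁻ y, ENNReal.ofReal (h y) ∂(uncoupledLaw κ m t x)).toReal -
      (∫⁻ y, ENNReal.ofReal (-h y) ∂(uncoupledLaw κ m t x)).toReal)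

lemma overlap_le_one (P Q : Measure S) [IsProbabilityMeasure P] : overlap P Q ≤ 1 := by
  unfold overlap
  calc ∫⁻ y, min (Q.rnDeriv P y) 1 ∂P ≤ ∫⁻ _, 1 ∂P := lintegral_mono fun y => min_le_right _ _
    _ = 1 := by simp

instance residual_isFiniteMeasure (P Q : Measure S) [IsProbabilityMeasure P]
    [IsProbabilityMeasure Q] : IsFiniteMeasure (residual P Q) := by
  unfold residual
  split_ifs with h
  · infer_instance
  · have h1 : 1 - overlap P Q ≠ 0 := by
      rw [Ne, tsub_eq_zero_iff_le, not_le]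
      exact lt_of_le_of_ne (overlap_le_one P Q) h
    have h2 : IsFiniteMeasure ((refMeasure P Q).withDensity (fun y =>
        P.rnDeriv (refMeasure P Q) y -
          min (P.rnDeriv (refMeasure P Q) y) (Q.rnDeriv (refMeasure P Q) y))) := by
      apply isFiniteMeasure_withDensity
      refine ne_of_lt (lt_of_le_of_lt (lintegral_mono fun y => tsub_le_self) ?_)
      exact Measure.lintegral_rnDeriv_lt_top _ _
    exact Measure.smul_finite _ (ENNReal.inv_ne_top.2 h1)

lemma V_eq_integral (κ : ℕ → Kernel S S) [∀ n, IsMarkovKernel (κ n)] (m t : ℕ)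
    (h : S × S → ℝ) (hm : Measurable h) (C : ℝ) (hC : ∀ x, |h x| ≤ C) (x : S × S) :
    V κ m t h x = (1 - (alpha κ m t x).toReal) * ∫ y, h y ∂(uncoupledLaw κ m t x) := by
  have : IsFiniteMeasure (uncoupledLaw κ m t x) := by unfold uncoupledLaw; infer_instance
  have hi : Integrable h (uncoupledLaw κ m t x) :=
    Integrable.of_bound hm.aestronglyMeasurable C (ae_of_all _ hC)
  rw [V, integral_eq_lintegral_pos_part_sub_lintegral_neg_part hi]

/-- The ordered product `V_0^{(m)} V_m^{(m)} V_{2m}^{(m)} ⋯ V_{(n-1)m}^{(m)}`. -/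
def prodV (κ : ℕ → Kernel S S) (m : ℕ) : ℕ → (S × S → ℝ) → (S × S → ℝ)
  | 0, h => h
  | n + 1, h => prodV κ m n (V κ m (n * m) h)

/-- The operator norm, with respect to the supremum norm, of an operator acting on bounded
measurable functions. -/
def opNorm {T : Type*} [MeasurableSpace T] (A : (T → ℝ) → (T → ℝ)) : ℝ≥0∞ :=
  ⨆ (h : T → ℝ) (_ : Measurable h) (_ : ∀ x, |h x| ≤ 1) (x : T), ENNReal.ofReal |A h x|

open scoped Classical in
/-- `∬ (∏_{i<n} V_{im}^{(m)} 1)(x¹, x²) 1(x¹ ≠ x²) μ¹(dx¹) μ²(dx²)`. -/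
def couplingIntegral (κ : ℕ → Kernel S S) (μ₁ μ₂ : Measure S) (m n : ℕ) : ℝ≥0∞ :=
  ∫⁻ x, ENNReal.ofReal (prodV κ m n (fun _ => 1) x * if x.1 ≠ x.2 then 1 else 0) ∂(μ₁.prod μ₂)

end NonhomChain

end

/-! The coupling argument is run in dual form, on test functions, so no coupled process is
constructed. Two laws `P`, `Q` share the mass `P ∧ Q`, which cancels in `∫ f dP - ∫ f dQ`; what
remains is `1 - α` times the difference of the residual means, at most `(1 - α) E|f(η¹) - f(η²)|`.
Hence averaging `f` over a block of length `m` turns the oscillation `pairDist f` into something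
dominated by `V (pairDist f)` (`pairDist_integral_trans_le`). The Markov property and monotonicity
of `V` iterate this over `n` blocks (`pairDist_integral_trans_le_prodV`).

Applied to indicators, with `pairDist f ≤ 1` and zero oscillation on the diagonal, this bounds total
variation at time `N` by twice the coupling integral for `N / m` blocks
(`tvDist_law_le_couplingIntegral`). That integral is at most the operator norm, whatever the initial
laws, hence the uniformity. `limsup_log_div_le` passes to exponential rates. -/

namespace NonhomChain

variable {S : Type*} [MeasurableSpace S]

/-! ### Common part and residual parts of two laws -/

section Overlap

variable (P Q : Measure S)

instance refMeasure_isFiniteMeasure [IsFiniteMeasure P] [IsFiniteMeasure Q] :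
    IsFiniteMeasure (refMeasure P Q) :=
  Measure.smul_finite _ (by simp)

lemma refMeasure_comm : refMeasure P Q = refMeasure Q P := by
  simp [refMeasure, add_comm]

lemma absolutelyContinuous_refMeasure_left : P ≪ refMeasure P Q :=
  ((Measure.AbsolutelyContinuous.refl P).add_right Q).trans
    (Measure.absolutelyContinuous_smul (by simp))

lemma absolutelyContinuous_refMeasure_right : Q ≪ refMeasure P Q :=
  refMeasure_comm Q P ▸ absolutelyContinuous_refMeasure_left Q P

/-- The common part `P ∧ Q` of two measures, with density `p ∧ q` with respect to `Λ`. -/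
noncomputable def commonPart : Measure S :=
  (refMeasure P Q).withDensity fun y =>
    min (P.rnDeriv (refMeasure P Q) y) (Q.rnDeriv (refMeasure P Q) y)

lemma commonPart_comm : commonPart P Q = commonPart Q P := by
  simp only [commonPart, refMeasure_comm P Q, min_comm]

variable [IsProbabilityMeasure P] [IsProbabilityMeasure Q]

/-- `P`-a.e. `dQ/dP = q / p`, and `p (q/p ∧ 1) = p ∧ q` wherever `p` is finite. This form makes the
symmetry in `P` and `Q` visible. -/
lemma overlap_eq_lintegral_min :
    overlap P Q = ∫⁻ y, min (P.rnDeriv (refMeasure P Q) y) (Q.rnDeriv (refMeasure P Q) y)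
      ∂(refMeasure P Q) := by
  have hP := absolutelyContinuous_refMeasure_left P Q
  have hQ := absolutelyContinuous_refMeasure_right P Q
  have h1 : overlap P Q = ∫⁻ y, min (Q.rnDeriv (refMeasure P Q) y / P.rnDeriv (refMeasure P Q) y) 1
      ∂P := by
    refine lintegral_congr_ae ?_
    filter_upwards [Measure.rnDeriv_eq_div (μ := Q) (ν := P) hQ hP] with y hy
    rw [hy]
  rw [h1, ← lintegral_rnDeriv_mul hP (by fun_prop)]
  refine lintegral_congr_ae ?_
  filter_upwards [Measure.rnDeriv_ne_top P (refMeasure P Q)] with y hy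
  rcases eq_or_ne (P.rnDeriv (refMeasure P Q) y) 0 with h0 | h0
  · simp [h0]
  · rw [mul_min, mul_one, ENNReal.mul_div_cancel h0 hy, min_comm]

lemma overlap_comm : overlap P Q = overlap Q P := by
  simp only [overlap_eq_lintegral_min, refMeasure_comm P Q, min_comm]

lemma lintegral_rnDeriv_sub_min :
    ∫⁻ y, (P.rnDeriv (refMeasure P Q) y -
      min (P.rnDeriv (refMeasure P Q) y) (Q.rnDeriv (refMeasure P Q) y)) ∂(refMeasure P Q)
      = 1 - overlap P Q := by
  rw [lintegral_sub (by fun_prop) _ (ae_of_all _ fun y => min_le_left _ _),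
    Measure.lintegral_rnDeriv (absolutelyContinuous_refMeasure_left P Q), measure_univ,
    overlap_eq_lintegral_min]
  rw [← overlap_eq_lintegral_min]
  exact ne_top_of_le_ne_top ENNReal.one_ne_top (overlap_le_one P Q)

lemma one_sub_overlap_smul_residual :
    (1 - overlap P Q) • residual P Q = (refMeasure P Q).withDensity (fun y =>
      P.rnDeriv (refMeasure P Q) y -
        min (P.rnDeriv (refMeasure P Q) y) (Q.rnDeriv (refMeasure P Q) y)) := by
  unfold residual
  split_ifs with h
  -- When the overlap is 1 the density on the right has total integral 0, so the default value of
  -- `residual` does not matter.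
  · rw [h, tsub_self, zero_smul, eq_comm, ← Measure.measure_univ_eq_zero,
      withDensity_apply _ MeasurableSet.univ, setLIntegral_univ, lintegral_rnDeriv_sub_min, h,
      tsub_self]
  · rw [smul_smul, ENNReal.mul_inv_cancel, one_smul]
    · rw [Ne, tsub_eq_zero_iff_le, not_le]
      exact lt_of_le_of_ne (overlap_le_one P Q) h
    · exact ne_top_of_le_ne_top ENNReal.one_ne_top tsub_le_self

instance residual_isProbabilityMeasure : IsProbabilityMeasure (residual P Q) := by
  by_cases h : overlap P Q = 1
  · simp only [residual, h, if_true]; infer_instance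
  · constructor
    have h0 : 1 - overlap P Q ≠ 0 := by
      rw [Ne, tsub_eq_zero_iff_le, not_le]
      exact lt_of_le_of_ne (overlap_le_one P Q) h
    simp only [residual, h, if_false, Measure.smul_apply, withDensity_apply _ MeasurableSet.univ,
      setLIntegral_univ, lintegral_rnDeriv_sub_min, smul_eq_mul]
    exact ENNReal.inv_mul_cancel h0 (ne_top_of_le_ne_top ENNReal.one_ne_top tsub_le_self)

lemma eq_smul_residual_add_commonPart :
    P = (1 - overlap P Q) • residual P Q + commonPart P Q := by
  rw [one_sub_overlap_smul_residual, commonPart, ← withDensity_add_right _ (by fun_prop)]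
  conv_lhs => rw [← Measure.withDensity_rnDeriv_eq _ _ (absolutelyContinuous_refMeasure_left P Q)]
  congr 1
  ext y
  exact (tsub_add_cancel_of_le (min_le_left _ _)).symm

instance commonPart_isFiniteMeasure : IsFiniteMeasure (commonPart P Q) :=
  isFiniteMeasure_of_le P (by
    conv_rhs => rw [eq_smul_residual_add_commonPart P Q]
    exact Measure.le_add_left le_rfl)

/-- The common part is symmetric in the two laws and cancels. -/
lemma integral_sub_integral_eq_residual (f : S → ℝ) (hf : Measurable f) (C : ℝ)
    (hC : ∀ y, |f y| ≤ C) :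
    ∫ y, f y ∂P - ∫ y, f y ∂Q =
      (1 - (overlap P Q).toReal) * (∫ y, f y ∂(residual P Q) - ∫ y, f y ∂(residual Q P)) := by
  have hi (μ : Measure S) [IsFiniteMeasure μ] : Integrable f μ :=
    Integrable.of_bound hf.aestronglyMeasurable C (ae_of_all _ hC)
  have key (P Q : Measure S) [IsProbabilityMeasure P] [IsProbabilityMeasure Q] :
      ∫ y, f y ∂P = (1 - (overlap P Q).toReal) * ∫ y, f y ∂(residual P Q)
        + ∫ y, f y ∂(commonPart P Q) := by
    have htop : 1 - overlap P Q ≠ ⊤ := ne_top_of_le_ne_top ENNReal.one_ne_top tsub_le_self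
    conv_lhs => rw [eq_smul_residual_add_commonPart P Q]
    rw [integral_add_measure ((hi _).smul_measure htop) (hi _), integral_smul_measure,
      ENNReal.toReal_sub_of_le (overlap_le_one P Q) ENNReal.one_ne_top, ENNReal.toReal_one,
      smul_eq_mul]
  rw [key P Q, key Q P, overlap_comm Q P, commonPart_comm Q P]
  ring

end Overlap

/-! ### Contraction of oscillations by the operators `V` -/

section Operators

/-- `x ↦ |f x¹ - f x²|`. -/
def pairDist (f : S → ℝ) (x : S × S) : ℝ := |f x.1 - f x.2|

variable (κ : ℕ → Kernel S S) [∀ n, IsMarkovKernel (κ n)]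

instance uncoupledLaw_isProbabilityMeasure (m t : ℕ) (x : S × S) :
    IsProbabilityMeasure (uncoupledLaw κ m t x) := by
  unfold uncoupledLaw; infer_instance

lemma alpha_toReal_le_one (m t : ℕ) (x : S × S) : (alpha κ m t x).toReal ≤ 1 :=
  ENNReal.toReal_le_of_le_ofReal zero_le_one (by
    rw [ENNReal.ofReal_one]; exact overlap_le_one _ _)

lemma V_of_nonneg (m t : ℕ) {h : S × S → ℝ} (h0 : ∀ x, 0 ≤ h x) (x : S × S) :
    V κ m t h x = (1 - (alpha κ m t x).toReal) *
      (∫⁻ y, ENNReal.ofReal (h y) ∂(uncoupledLaw κ m t x)).toReal := by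
  have : ∀ y, ENNReal.ofReal (-h y) = 0 := fun y =>
    ENNReal.ofReal_of_nonpos (neg_nonpos.2 (h0 y))
  simp [V, this]

lemma lintegral_ofReal_le_one {T : Type*} [MeasurableSpace T] (μ : Measure T)
    [IsProbabilityMeasure μ] {h : T → ℝ} (h1 : ∀ x, h x ≤ 1) :
    ∫⁻ y, ENNReal.ofReal (h y) ∂μ ≤ 1 :=
  (lintegral_mono fun y => ENNReal.ofReal_le_one.2 (h1 y)).trans (by simp)

lemma V_nonneg (m t : ℕ) {h : S × S → ℝ} (h0 : ∀ x, 0 ≤ h x) (x : S × S) :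
    0 ≤ V κ m t h x := by
  rw [V_of_nonneg κ m t h0]
  exact mul_nonneg (sub_nonneg.2 (alpha_toReal_le_one κ m t x)) ENNReal.toReal_nonneg

lemma V_le_one (m t : ℕ) {h : S × S → ℝ} (h0 : ∀ x, 0 ≤ h x) (h1 : ∀ x, h x ≤ 1) (x : S × S) :
    V κ m t h x ≤ 1 := by
  rw [V_of_nonneg κ m t h0]
  refine mul_le_one₀ (by simp) ENNReal.toReal_nonneg ?_
  exact ENNReal.toReal_le_of_le_ofReal zero_le_one (by simpa using lintegral_ofReal_le_one _ h1)

/-- Measurability is not assumed, since it is not known for iterates of `V`; lower integrals are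
monotone anyway. The bound by 1 keeps them finite, so that `toReal` preserves the order. -/
lemma V_mono (m t : ℕ) {g h : S × S → ℝ} (g0 : ∀ x, 0 ≤ g x) (gh : ∀ x, g x ≤ h x)
    (h1 : ∀ x, h x ≤ 1) (x : S × S) : V κ m t g x ≤ V κ m t h x := by
  rw [V_of_nonneg κ m t g0, V_of_nonneg κ m t fun x => (g0 x).trans (gh x)]
  refine mul_le_mul_of_nonneg_left ?_ (sub_nonneg.2 (alpha_toReal_le_one κ m t x))
  refine ENNReal.toReal_mono ?_ (lintegral_mono fun y => ENNReal.ofReal_le_ofReal (gh y))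
  exact ne_top_of_le_ne_top ENNReal.one_ne_top (lintegral_ofReal_le_one _ h1)

lemma prodV_mono (m n : ℕ) {g h : S × S → ℝ} (g0 : ∀ x, 0 ≤ g x) (gh : ∀ x, g x ≤ h x)
    (h1 : ∀ x, h x ≤ 1) (x : S × S) : prodV κ m n g x ≤ prodV κ m n h x := by
  induction n generalizing g h with
  | zero => exact gh x
  | succ n ih =>
    exact ih (V_nonneg κ m _ g0) (V_mono κ m _ g0 gh h1)
      (V_le_one κ m _ (fun x => (g0 x).trans (gh x)) h1)

lemma integral_trans_add (t m k : ℕ) (x : S) {f : S → ℝ} (hf : Measurable f)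
    (hC : ∀ y, |f y| ≤ 1) :
    ∫ y, f y ∂(trans κ t (m + k) x) = ∫ z, ∫ y, f y ∂(trans κ (t + m) k z) ∂(trans κ t m x) := by
  have hcomp : trans κ t (m + k) = (trans κ (t + m) k).comp (trans κ t m) := by
    induction k with
    | zero => simp [trans]
    | succ k ih =>
      rw [← add_assoc]
      simp only [trans]
      rw [ih, Kernel.comp_assoc, add_assoc]
  rw [hcomp]
  rw [Kernel.integral_comp]
  exact Integrable.of_bound hf.aestronglyMeasurable 1 (ae_of_all _ hC)

lemma measurable_integral_kernel {T : Type*} [MeasurableSpace T] (η : Kernel T S)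
    {f : S → ℝ} (hf : Measurable f) :
    Measurable fun x => ∫ y, f y ∂(η x) :=
  hf.stronglyMeasurable.integral_kernel.measurable

lemma integral_mem_Icc {μ : Measure S} [IsProbabilityMeasure μ] {f : S → ℝ} (hf : Measurable f)
    (h0 : ∀ y, f y ∈ Set.Icc (0 : ℝ) 1) : ∫ y, f y ∂μ ∈ Set.Icc (0 : ℝ) 1 := by
  have hi : Integrable f μ := Integrable.of_mem_Icc 0 1 hf.aemeasurable (ae_of_all _ h0)
  refine ⟨integral_nonneg fun y => (h0 y).1, ?_⟩
  simpa using integral_mono hi (integrable_const (1 : ℝ)) fun y => (h0 y).2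

lemma abs_le_one_of_mem_Icc {a : ℝ} (h : a ∈ Set.Icc (0 : ℝ) 1) : |a| ≤ 1 := by
  rw [abs_of_nonneg h.1]; exact h.2

lemma pairDist_nonneg {T : Type*} (f : T → ℝ) (x : T × T) : 0 ≤ pairDist f x := abs_nonneg _

lemma pairDist_le_one {T : Type*} {f : T → ℝ} (hf : ∀ y, f y ∈ Set.Icc (0 : ℝ) 1) (x : T × T) :
    pairDist f x ≤ 1 := by
  have h1 := hf x.1
  have h2 := hf x.2
  exact abs_le.2 ⟨by linarith [h1.1, h2.2], by linarith [h1.2, h2.1]⟩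

lemma measurable_pairDist {f : S → ℝ} (hf : Measurable f) : Measurable (pairDist f) := by
  unfold pairDist
  exact ((hf.comp measurable_fst).sub (hf.comp measurable_snd)).abs

/-- Both means are integrals against the independent coupling `μ.prod ν`. -/
lemma abs_integral_sub_le_integral_pairDist (μ ν : Measure S) [IsProbabilityMeasure μ]
    [IsProbabilityMeasure ν] {f : S → ℝ} (hf : Measurable f)
    (h0 : ∀ y, f y ∈ Set.Icc (0 : ℝ) 1) :
    |∫ y, f y ∂μ - ∫ y, f y ∂ν| ≤ ∫ x, pairDist f x ∂(μ.prod ν) := by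
  have hi (μ : Measure S) [IsProbabilityMeasure μ] : Integrable f μ :=
    Integrable.of_mem_Icc 0 1 hf.aemeasurable (ae_of_all _ h0)
  have : ∫ y, f y ∂μ - ∫ y, f y ∂ν = ∫ x, (f x.1 - f x.2) ∂(μ.prod ν) := by
    rw [integral_sub ((hi μ).comp_fst ν) ((hi ν).comp_snd μ), integral_fun_fst, integral_fun_snd]
    simp
  rw [this]
  exact abs_integral_le_integral_abs

/-- One step of the coupling: the oscillation of `E f` after one step is at most `V` applied to
the oscillation of `f`. -/
lemma pairDist_integral_trans_le (m t : ℕ) {f : S → ℝ} (hf : Measurable f)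
    (h0 : ∀ y, f y ∈ Set.Icc (0 : ℝ) 1) (x : S × S) :
    pairDist (fun z => ∫ y, f y ∂(trans κ t m z)) x ≤ V κ m t (pairDist f) x := by
  rw [V_eq_integral κ m t _ (measurable_pairDist hf) 1 fun x => by
    rw [abs_of_nonneg (pairDist_nonneg f x)]; exact pairDist_le_one h0 x]
  have hα := sub_nonneg.2 (alpha_toReal_le_one κ m t x)
  rw [pairDist, integral_sub_integral_eq_residual _ _ f hf 1 fun y => abs_le_one_of_mem_Icc (h0 y),
    abs_mul, abs_of_nonneg (by exact hα)]
  exact mul_le_mul_of_nonneg_left (abs_integral_sub_le_integral_pairDist _ _ hf h0) hα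

/-- The induction splits off the last block, the innermost factor of the product. The averaged
function is again measurable, so the one-step bound is only ever used for measurable `f`. -/
lemma pairDist_integral_trans_le_prodV (m n : ℕ) {f : S → ℝ} (hf : Measurable f)
    (h0 : ∀ y, f y ∈ Set.Icc (0 : ℝ) 1) (x : S × S) :
    pairDist (fun z => ∫ y, f y ∂(trans κ 0 (n * m) z)) x ≤ prodV κ m n (pairDist f) x := by
  induction n generalizing f with
  | zero =>
    have : ∀ z, ∫ y, f y ∂(trans κ 0 (0 * m) z) = f z := fun z => by
      simp [trans, Kernel.id_apply, integral_dirac' _ _ hf.stronglyMeasurable]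
    simp only [this]; exact le_rfl
  | succ n ih =>
    have h0' : ∀ z, ∫ y, f y ∂(trans κ (n * m) m z) ∈ Set.Icc (0 : ℝ) 1 :=
      fun z => integral_mem_Icc hf h0
    have hs : ∀ z, ∫ y, f y ∂(trans κ 0 ((n + 1) * m) z) =
        ∫ w, ∫ y, f y ∂(trans κ (n * m) m w) ∂(trans κ 0 (n * m) z) := fun z => by
      rw [add_mul, one_mul, integral_trans_add κ _ _ _ _ hf fun y => abs_le_one_of_mem_Icc (h0 y),
        zero_add]
    simp only [hs]
    refine (ih (measurable_integral_kernel _ hf) h0').trans ?_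
    exact prodV_mono κ m n (pairDist_nonneg _) (pairDist_integral_trans_le κ m _ hf h0)
      (V_le_one κ m _ (pairDist_nonneg f) (pairDist_le_one h0)) x

lemma abs_law_sub_le_couplingIntegral (μ₁ μ₂ : Measure S) [IsProbabilityMeasure μ₁]
    [IsProbabilityMeasure μ₂] (m n r : ℕ) {A : Set S} (hA : MeasurableSet A) :
    ENNReal.ofReal |(law κ μ₁ (n * m + r)).real A - (law κ μ₂ (n * m + r)).real A| ≤
      couplingIntegral κ μ₁ μ₂ m n := by
  -- The last `r` steps, which do not fill a block, are absorbed into the test function.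
  set f : S → ℝ := fun z => ∫ y, A.indicator 1 y ∂(trans κ (n * m) r z) with hf_def
  have hA1 : Measurable (A.indicator (1 : S → ℝ)) := measurable_one.indicator hA
  have hA2 : ∀ y, A.indicator (1 : S → ℝ) y ∈ Set.Icc (0 : ℝ) 1 := fun y => by
    by_cases h : y ∈ A <;> simp [h]
  have hf : Measurable f := measurable_integral_kernel _ hA1
  have hf0 : ∀ y, f y ∈ Set.Icc (0 : ℝ) 1 := fun y => integral_mem_Icc hA1 hA2
  set F : S → ℝ := fun z => ∫ y, f y ∂(trans κ 0 (n * m) z) with hF_def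
  have hF : Measurable F := measurable_integral_kernel _ hf
  have hF0 : ∀ y, F y ∈ Set.Icc (0 : ℝ) 1 := fun y => integral_mem_Icc hf hf0
  have hlaw (μ : Measure S) [IsProbabilityMeasure μ] :
      (law κ μ (n * m + r)).real A = ∫ z, F z ∂μ := by
    have : ∀ z, F z = (trans κ 0 (n * m + r) z).real A := fun z => by
      rw [← integral_indicator_one hA,
        integral_trans_add κ _ _ _ _ hA1 fun y => abs_le_one_of_mem_Icc (hA2 y), zero_add]
    simp only [this, measureReal_def, law]
    rw [integral_toReal (Kernel.measurable_coe _ hA).aemeasurable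
      (ae_of_all _ fun _ => measure_lt_top _ _), Measure.bind_apply hA (Kernel.aemeasurable _)]
  rw [hlaw μ₁, hlaw μ₂]
  calc ENNReal.ofReal |∫ z, F z ∂μ₁ - ∫ z, F z ∂μ₂|
      ≤ ENNReal.ofReal (∫ x, pairDist F x ∂(μ₁.prod μ₂)) :=
        ENNReal.ofReal_le_ofReal (abs_integral_sub_le_integral_pairDist _ _ hF hF0)
    _ = ∫⁻ x, ENNReal.ofReal (pairDist F x) ∂(μ₁.prod μ₂) :=
        ofReal_integral_eq_lintegral_ofReal
          (Integrable.of_mem_Icc 0 1 (measurable_pairDist hF).aemeasurable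
            (ae_of_all _ fun x => ⟨pairDist_nonneg F x, pairDist_le_one hF0 x⟩))
          (ae_of_all _ (pairDist_nonneg F))
    _ ≤ couplingIntegral κ μ₁ μ₂ m n := by
        refine lintegral_mono fun x => ENNReal.ofReal_le_ofReal ?_
        by_cases h : x.1 = x.2
        · simp [pairDist, h]
        · simp only [ne_eq, h, not_false_eq_true, if_true, mul_one]
          exact (pairDist_integral_trans_le_prodV κ m n hf hf0 x).trans
            (prodV_mono κ m n (pairDist_nonneg f) (pairDist_le_one hf0) (fun _ => le_rfl) x)

/-- The two sets of a Hahn decomposition contribute at most `C` each. -/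
lemma tvDist_le_of_forall (μ ν : Measure S) [IsFiniteMeasure μ] [IsFiniteMeasure ν] (C : ℝ≥0∞)
    (hC : ∀ A, MeasurableSet A → ENNReal.ofReal |μ.real A - ν.real A| ≤ C) :
    tvDist μ ν ≤ 2 * C := by
  set s := μ.toSignedMeasure - ν.toSignedMeasure with hs
  have hsA : ∀ A, MeasurableSet A → s A = μ.real A - ν.real A := fun A hA =>
    Measure.toSignedMeasure_sub_apply hA
  obtain ⟨i, hi, h0, h1, hp, hn⟩ := s.toJordanDecomposition_spec
  rw [tvDist, ← hs, SignedMeasure.totalVariation, Measure.add_apply, two_mul]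
  refine add_le_add ?_ ?_
  · rw [← ENNReal.ofReal_toReal (measure_ne_top _ _), ← measureReal_def, hp,
      s.toMeasureOfZeroLE_real_apply h0 hi MeasurableSet.univ, Set.inter_univ, hsA i hi]
    exact (ENNReal.ofReal_le_ofReal (le_abs_self _)).trans (hC i hi)
  · rw [← ENNReal.ofReal_toReal (measure_ne_top _ _), ← measureReal_def, hn,
      s.toMeasureOfLEZero_real_apply h1 hi.compl MeasurableSet.univ, Set.inter_univ,
      hsA _ hi.compl]
    exact (ENNReal.ofReal_le_ofReal (neg_le_abs _)).trans (hC _ hi.compl)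

lemma tvDist_law_le_couplingIntegral (μ₁ μ₂ : Measure S) [IsProbabilityMeasure μ₁]
    [IsProbabilityMeasure μ₂] (m N : ℕ) :
    tvDist (law κ μ₁ N) (law κ μ₂ N) ≤ 2 * couplingIntegral κ μ₁ μ₂ m (N / m) := by
  refine tvDist_le_of_forall _ _ _ fun A hA => ?_
  have h := abs_law_sub_le_couplingIntegral κ μ₁ μ₂ m (N / m) (N % m) hA
  simpa only [Nat.div_add_mod'] using h

end Operators

/-! ### Operator norm and exponential rates -/

open scoped Classical in
lemma couplingIntegral_le_opNorm (κ : ℕ → Kernel S S) (μ₁ μ₂ : Measure S) [IsProbabilityMeasure μ₁]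
    [IsProbabilityMeasure μ₂] (m n : ℕ) :
    couplingIntegral κ μ₁ μ₂ m n ≤ opNorm (prodV κ m n) := by
  have h : ∀ x : S × S, ENNReal.ofReal (prodV κ m n (fun _ => 1) x * if x.1 ≠ x.2 then 1 else 0)
      ≤ opNorm (prodV κ m n) := fun x => by
    refine le_trans (ENNReal.ofReal_le_ofReal ?_) (le_iSup₂_of_le (fun _ => (1 : ℝ))
      measurable_const (le_iSup₂_of_le (by simp) x le_rfl))
    split_ifs
    · simpa using le_abs_self _
    · simp
  calc couplingIntegral κ μ₁ μ₂ m n ≤ ∫⁻ _, opNorm (prodV κ m n) ∂(μ₁.prod μ₂) :=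
        lintegral_mono h
    _ = opNorm (prodV κ m n) := by simp

lemma limsup_log_div_le {T c : ℕ → ℝ≥0∞} {m : ℕ} (hm : 1 ≤ m)
    (h : ∀ N, T N ≤ 2 * c (N / m)) :
    limsup (fun n : ℕ => ENNReal.log (T n) / (n : EReal)) atTop ≤
      limsup (fun n : ℕ => ENNReal.log (c n) / ((n * m : ℕ) : EReal)) atTop := by
  refine le_of_forall_gt_imp_ge_of_dense fun b hb => ?_
  induction b with
  | bot => exact absurd hb not_lt_bot
  | top => exact le_top
  | coe a =>
    -- The comparison sequence is `(log 2 + (N / m * m) a) / N`, with floor division, rewritten by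
    -- `N / m * m = N - N % m`. Since `a` may be negative, the remainder term cannot be dropped, but
    -- it is bounded.
    have hlim : Tendsto (fun N : ℕ => (Real.log 2 - (N % m : ℕ) * a) / (N : ℝ) + a) atTop
        (nhds a) := by
      have hbd : ∀ N : ℕ, |Real.log 2 - (N % m : ℕ) * a| ≤ |Real.log 2| + m * |a| := fun N => by
        refine (abs_sub _ _).trans (add_le_add_right ?_ _)
        rw [abs_mul, Nat.abs_cast]
        exact mul_le_mul_of_nonneg_right (by exact_mod_cast (Nat.mod_lt N hm).le) (abs_nonneg _)
      simpa using (tendsto_bdd_div_atTop_nhds_zero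
        (Eventually.of_forall fun N => (abs_le.1 (hbd N)).1)
        (Eventually.of_forall fun N => (abs_le.1 (hbd N)).2)
        tendsto_natCast_atTop_atTop).add_const a
    rw [← ((continuous_coe_real_ereal.tendsto a).comp hlim).limsup_eq]
    refine limsup_le_limsup ?_
    filter_upwards [(Nat.tendsto_div_const_atTop (by lia : m ≠ 0)).eventually
      (eventually_lt_of_limsup_lt hb), eventually_ge_atTop m] with N hN hmN
    have hN0 : 0 < N := by lia
    have hq : 0 < N / m * m := Nat.mul_pos (Nat.div_pos hmN hm) hm
    rw [EReal.div_le_iff_le_mul (by exact_mod_cast hN0) (EReal.natCast_ne_top N)]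
    have h1 : ENNReal.log (c (N / m)) ≤ ((N / m * m : ℕ) : EReal) * a :=
      (EReal.div_le_iff_le_mul (by exact_mod_cast hq) (EReal.natCast_ne_top _)).1 hN.le
    have h2 : ENNReal.log 2 = ((Real.log 2 : ℝ) : EReal) := by
      simpa using ENNReal.log_ofReal_of_pos (x := 2) two_pos
    calc ENNReal.log (T N) ≤ ENNReal.log (2 * c (N / m)) := ENNReal.log_le_log (h N)
      _ = Real.log 2 + ENNReal.log (c (N / m)) := by rw [ENNReal.log_mul_add, h2]
      _ ≤ Real.log 2 + ((N / m * m : ℕ) : EReal) * a := by gcongr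
      _ = ((Real.log 2 + (N / m * m : ℕ) * a : ℝ) : EReal) := by push_cast; rfl
      _ = ((N * ((Real.log 2 - (N % m : ℕ) * a) / (N : ℝ) + a) : ℝ) : EReal) := by
        have hN' : (N : ℝ) ≠ 0 := by exact_mod_cast hN0.ne'
        have hdm : ((N / m * m : ℕ) : ℝ) + (N % m : ℕ) = N := by
          exact_mod_cast Nat.div_add_mod' N m
        congr 1
        field_simp
        rw [← hdm]
        ring
      _ = _ := by push_cast; rfl

end NonhomChain

theorem mainTheorem6 {S : Type*} [MeasurableSpace S] (κ : ℕ → Kernel S S)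
    [∀ n, IsMarkovKernel (κ n)] :
    (∀ (μ₁ μ₂ : ProbabilityMeasure S) (m : ℕ), 1 ≤ m →
      limsup (fun n : ℕ =>
        ENNReal.log (NonhomChain.tvDist (NonhomChain.law κ μ₁ n) (NonhomChain.law κ μ₂ n))
          / (n : EReal)) atTop
      ≤ limsup (fun n : ℕ =>
        ENNReal.log (NonhomChain.couplingIntegral κ μ₁ μ₂ m n) / ((n * m : ℕ) : EReal)) atTop) ∧
    (∀ μ₁ μ₂ : ProbabilityMeasure S,
      limsup (fun n : ℕ =>
        ENNReal.log (NonhomChain.tvDist (NonhomChain.law κ μ₁ n) (NonhomChain.law κ μ₂ n))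
          / (n : EReal)) atTop
      ≤ liminf (fun m : ℕ => limsup (fun n : ℕ =>
        ENNReal.log (NonhomChain.opNorm (NonhomChain.prodV κ m n)) / ((n * m : ℕ) : EReal))
          atTop) atTop) ∧
    (limsup (fun n : ℕ =>
        ENNReal.log (⨆ (μ₁ : ProbabilityMeasure S) (μ₂ : ProbabilityMeasure S),
          NonhomChain.tvDist (NonhomChain.law κ μ₁ n) (NonhomChain.law κ μ₂ n))
          / (n : EReal)) atTop
      ≤ liminf (fun m : ℕ => limsup (fun n : ℕ =>
        ENNReal.log (NonhomChain.opNorm (NonhomChain.prodV κ m n)) / ((n * m : ℕ) : EReal))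
          atTop) atTop) := by
  have h3 : limsup (fun n : ℕ =>
        ENNReal.log (⨆ (μ₁ : ProbabilityMeasure S) (μ₂ : ProbabilityMeasure S),
          NonhomChain.tvDist (NonhomChain.law κ μ₁ n) (NonhomChain.law κ μ₂ n))
          / (n : EReal)) atTop
      ≤ liminf (fun m : ℕ => limsup (fun n : ℕ =>
        ENNReal.log (NonhomChain.opNorm (NonhomChain.prodV κ m n)) / ((n * m : ℕ) : EReal))
          atTop) atTop := by
    refine le_liminf_of_le (by isBoundedDefault) ?_
    filter_upwards [eventually_ge_atTop 1] with m hm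
    refine NonhomChain.limsup_log_div_le hm fun N => iSup₂_le fun μ₁ μ₂ => ?_
    refine (NonhomChain.tvDist_law_le_couplingIntegral κ μ₁ μ₂ m N).trans ?_
    gcongr
    exact NonhomChain.couplingIntegral_le_opNorm κ μ₁ μ₂ m _
  refine ⟨fun μ₁ μ₂ m hm => NonhomChain.limsup_log_div_le hm
    (NonhomChain.tvDist_law_le_couplingIntegral κ μ₁ μ₂ m), fun μ₁ μ₂ => ?_, h3⟩
  -- For a fixed pair of initial laws the distance is at most the supremum over all pairs.
  refine (limsup_le_limsup (Eventually.of_forall fun n => ?_)).trans h3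
  refine EReal.div_le_div_right_of_nonneg (by positivity) (ENNReal.log_le_log ?_)
  exact le_iSup₂ (f := fun (μ₁ μ₂ : ProbabilityMeasure S) =>
    NonhomChain.tvDist (NonhomChain.law κ μ₁ n) (NonhomChain.law κ μ₂ n)) μ₁ μ₂
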